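/- Let $\Gamma$ be a nontrivial discrete group acting by homeomorphisms on a compact Hausdorff space $X$, and let $\mathcal G=\Gamma\ltimes X$ be the transformation groupoid: the space $\Gamma\times X$ with source $s(g,x)=x$, range $r(g,x)=g\cdot x$, product $(g,h\cdot x)(h,x)=(gh,x)$, inverse $(g,x)^{-1}=(g^{-1},g\cdot x)$ and unit space $\mathcal G^{(0)}=\{e\}\times X\cong X$; write $\mathcal G_x=s^{-1}(x)$. Let $\ell:\mathcal G\to[0,\infty)$ be a continuous length function, i.e. $\ell(\gamma)=0$ iff $\gamma\in\mathcal G^{(0)}$, $\ell(\gamma^{-1})=\ell(\gamma)$, and $\ell(\gamma\eta)\le\ell(\gamma)+\ell(\eta)$ for composable $\gamma,\eta$. Suppose that $\ell$ is proper: every $K\subseteq\mathcal G\setminus\mathcal G^{(0)}$ on which $\ell$ is bounded is pre-compact. Let $L^2(\mathcal G)$ be the completion of $C_c(\mathcal G)$ in the norm $\|\xi\|=\sup_{x\in X}\bigl(\sum_{\gamma\in\mathcal G_x}|\xi(\gamma)|^2\bigr)^{1/2}$. For $f\in C_c(\mathcal G)$ let $\lambda(f)$ be the bounded operator on $L^2(\mathcal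 G)$ with $(\lambda(f)\xi)(\gamma)=\sum_{\beta\in\mathcal G_{s(\gamma)}}f(\gamma\beta^{-1})\xi(\beta)$ for $\xi\in C_c(\mathcal G)$, put $\|f\|_{\mathrm{red}}=\|\lambda(f)\|$, and let $C^*_r(\mathcal G)$ be the completion of $C_c(\mathcal G)$ in $\|\cdot\|_{\mathrm{red}}$. Let $M_\ell$ be multiplication by $\ell$ on $C_c(\mathcal G)$, let $\Delta^0(f)=\lambda(f)$ and $\Delta^{k}(f)=[M_\ell,\Delta^{k-1}(f)]$ for $k\ge 1$; each $\Delta^k(f)$ extends to a bounded operator on $L^2(\mathcal G)$, and $L^k_\ell(f):=\|\Delta^k(f)\|$. Suppose that $\mathcal G$ has rapid decay with respect to $\ell$: there are constants $C,p>0$ such that $\|f\|_{\mathrm{red}}\le C\|f\|_{2,p,\ell}$ for all $f\in C_c(\mathcal G)$, where $$\|f\|_{2,p,\ell}=\max\Bigl\{\sup_{x\in X}\Bigl(\sum_{\gamma\in\mathcal G_x}|f(\gamma)|^2(1+\ell(\gamma))^{2p}\Bigr)^{1/2},\ \sup_{x\in X}\Bigl(\sum_{\gamma\in\mathcal G_x}|f(\gamma^{-1})|^2(1+\ell(\gamma))^{2p}\Bigr)^{1/2}\Bigr\}.$$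 For $k\ge1$ put $\mathcal L'_{1,k}=\{f\in C_c(\mathcal G): L^k_\ell(f)\le 1,\ f|_X\equiv 0\}$. Then the following are equivalent: (i) there is an integer $k\ge1$ such that $\mathcal L'_{1,k}$ is totally bounded in $C^*_r(\mathcal G)$ with respect to $\|\cdot\|_{\mathrm{red}}$; (ii) $X$ is finite. -/

import Mathlib

open scoped CompactlySupported

noncomputable section

set_option linter.unusedSectionVars false

/-! ### The transformation groupoid `Γ ⋉ X` -/

/-- The space of arrows of the transformation groupoid `Γ ⋉ X` of an action of a discrete group `Γ`
on a space `X`, with the product topology. The arrow `(g, x)` has source `x` and range `g • x`. -/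
abbrev TransformationGroupoid (Γ X : Type*) := Γ × X

namespace TransformationGroupoid

variable {Γ X : Type*} [Group Γ] [MulAction Γ X]

/-- The source map `s (g, x) = x`; a point `x` of `X` is identified with the unit `(1, x)`. -/
def src (γ : TransformationGroupoid Γ X) : X := γ.2

/-- The range map `r (g, x) = g • x`. -/
def rng (γ : TransformationGroupoid Γ X) : X := γ.1 • γ.2

/-- The inverse `(g, x)⁻¹ = (g⁻¹, g • x)`. -/
def inv (γ : TransformationGroupoid Γ X) : TransformationGroupoid Γ X := (γ.1⁻¹, γ.1 • γ.2)

/-- The product `(g, h • x) (h, x) = (g * h, x)`, meaningful for composable pairs, that is, when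
`src γ = rng η`. -/
def mul (γ η : TransformationGroupoid Γ X) : TransformationGroupoid Γ X := (γ.1 * η.1, η.2)

variable (Γ X) in
/-- The unit space `{1} × X`. -/
def units : Set (TransformationGroupoid Γ X) := {γ | γ.1 = 1}

end TransformationGroupoid

open TransformationGroupoid

section

variable (Γ X : Type*) [Group Γ] [TopologicalSpace Γ] [TopologicalSpace X] [MulAction Γ X]

/-- A (continuous) length function on the transformation groupoid. -/
structure LengthFunction extends C(TransformationGroupoid Γ X, ℝ) where
  nonneg : ∀ γ, 0 ≤ toFun γ
  eq_zero_iff : ∀ γ, toFun γ = 0 ↔ γ ∈ units Γ X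
  map_inv : ∀ γ, toFun (inv γ) = toFun γ
  map_mul_le : ∀ γ η, src γ = rng η → toFun (mul γ η) ≤ toFun γ + toFun η

instance : CoeFun (LengthFunction Γ X) fun _ => TransformationGroupoid Γ X → ℝ :=
  ⟨fun ℓ => ℓ.toFun⟩

variable {Γ X} in
/-- A length function is proper if every set of non-units on which it is bounded is
pre-compact. -/
def LengthFunction.IsProper (ℓ : LengthFunction Γ X) : Prop :=
  ∀ K : Set (TransformationGroupoid Γ X), K ⊆ (units Γ X)ᶜ → BddAbove ((fun γ => ℓ γ) '' K) →
    IsCompact (closure K)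

end

/-! ### The Hilbert module `L²(Γ ⋉ X)` -/

section

variable (Γ X : Type*) [TopologicalSpace Γ] [TopologicalSpace X]

/-- The space `C_c (Γ ⋉ X)`, as a type that will carry the norm of `L²(Γ ⋉ X)`. -/
def PreL2 := C_c(TransformationGroupoid Γ X, ℂ)

instance : AddCommGroup (PreL2 Γ X) :=
  inferInstanceAs (AddCommGroup C_c(TransformationGroupoid Γ X, ℂ))

instance : Module ℂ (PreL2 Γ X) :=
  inferInstanceAs (Module ℂ C_c(TransformationGroupoid Γ X, ℂ))

instance : FunLike (PreL2 Γ X) (TransformationGroupoid Γ X) ℂ :=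
  inferInstanceAs (FunLike C_c(TransformationGroupoid Γ X, ℂ) (TransformationGroupoid Γ X) ℂ)

variable {Γ X}

/-- The `ℓ²`-norm of `ξ` on the source fibre of `x`, which is `{(g, x) | g ∈ Γ}`. -/
def fibreNorm (ξ : PreL2 Γ X) (x : X) : ℝ := √(∑' g : Γ, ‖ξ (g, x)‖ ^ 2)

/-- The norm `‖ξ‖ = sup_x (∑_{γ ∈ G_x} |ξ γ|²)^{1/2}`. -/
instance : Norm (PreL2 Γ X) := ⟨fun ξ => ⨆ x : X, fibreNorm ξ x⟩

theorem PreL2.norm_def (ξ : PreL2 Γ X) : ‖ξ‖ = ⨆ x : X, fibreNorm ξ x := rfl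

theorem PreL2.add_apply (ξ η : PreL2 Γ X) (γ) : (ξ + η) γ = ξ γ + η γ := rfl

theorem PreL2.sub_apply (ξ η : PreL2 Γ X) (γ) : (ξ - η) γ = ξ γ - η γ :=
  CompactlySupportedContinuousMap.sub_apply γ ξ η

theorem PreL2.smul_apply (c : ℂ) (ξ : PreL2 Γ X) (γ) : (c • ξ) γ = c * ξ γ := rfl

theorem PreL2.continuous_coe (ξ : PreL2 Γ X) : Continuous ξ :=
  ContinuousMap.continuous_toFun (CompactlySupportedContinuousMap.toContinuousMap ξ)

/-- Functions in `C_c (Γ ⋉ X)` live on finitely many group elements. -/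
theorem exists_finset_supp [DiscreteTopology Γ] (f : C_c(TransformationGroupoid Γ X, ℂ)) :
    ∃ S : Finset Γ, ∀ g ∉ S, ∀ x, f (g, x) = 0 := by
  have h : (Prod.fst '' tsupport f).Finite :=
    (f.hasCompactSupport'.isCompact.image continuous_fst).finite_of_discrete
  refine ⟨h.toFinset, fun g hg x => ?_⟩
  by_contra hne
  exact hg (h.mem_toFinset.2 ⟨(g, x), subset_tsupport _ hne, rfl⟩)

theorem exists_finset_support [DiscreteTopology Γ] (ξ : PreL2 Γ X) :
    ∃ S : Finset Γ, ∀ g ∉ S, ∀ x, ξ (g, x) = 0 :=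
  exists_finset_supp ξ

theorem fibreNorm_eq {ξ : PreL2 Γ X} {S : Finset Γ} (hS : ∀ g ∉ S, ∀ x, ξ (g, x) = 0) (x : X) :
    fibreNorm ξ x = √(∑ g ∈ S, ‖ξ (g, x)‖ ^ 2) := by
  rw [fibreNorm, tsum_eq_sum fun g hg => by simp [hS g hg x]]

theorem fibreNorm_add_le [DiscreteTopology Γ] (ξ η : PreL2 Γ X) (x : X) :
    fibreNorm (ξ + η) x ≤ fibreNorm ξ x + fibreNorm η x := by
  classical
  obtain ⟨S, hS⟩ := exists_finset_support ξ
  obtain ⟨T, hT⟩ := exists_finset_support η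
  have hS' : ∀ g ∉ S ∪ T, ∀ x, ξ (g, x) = 0 := fun g hg x => hS g (by grind) x
  have hT' : ∀ g ∉ S ∪ T, ∀ x, η (g, x) = 0 := fun g hg x => hT g (by grind) x
  have hST : ∀ g ∉ S ∪ T, ∀ x, (ξ + η) (g, x) = 0 := fun g hg x => by
    rw [PreL2.add_apply, hS' g hg, hT' g hg, add_zero]
  rw [fibreNorm_eq hS', fibreNorm_eq hT', fibreNorm_eq hST]
  have key := norm_add_le
    (WithLp.toLp 2 (fun i : (S ∪ T : Finset Γ) => ξ (i.1, x)) : EuclideanSpace ℂ _)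
    (WithLp.toLp 2 (fun i : (S ∪ T : Finset Γ) => η (i.1, x)))
  simp only [EuclideanSpace.norm_eq, PiLp.add_apply] at key
  rw [Finset.sum_coe_sort (S ∪ T) (fun i => ‖ξ (i, x) + η (i, x)‖ ^ 2),
    Finset.sum_coe_sort (S ∪ T) (fun i => ‖ξ (i, x)‖ ^ 2),
    Finset.sum_coe_sort (S ∪ T) (fun i => ‖η (i, x)‖ ^ 2)] at key
  exact key

theorem bddAbove_fibreNorm [DiscreteTopology Γ] [CompactSpace X] (ξ : PreL2 Γ X) :
    BddAbove (Set.range (fibreNorm ξ)) := by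
  obtain ⟨S, hS⟩ := exists_finset_support ξ
  have hc : Continuous (fibreNorm ξ) := by
    rw [funext (fibreNorm_eq hS)]
    have := ξ.continuous_coe
    fun_prop
  exact (isCompact_range hc).bddAbove

theorem fibreNorm_le_norm [DiscreteTopology Γ] [CompactSpace X] (ξ : PreL2 Γ X) (x : X) :
    fibreNorm ξ x ≤ ‖ξ‖ :=
  le_ciSup (bddAbove_fibreNorm ξ) x

theorem PreL2.norm_le {ξ : PreL2 Γ X} {C : ℝ} (hC : 0 ≤ C) (h : ∀ x, fibreNorm ξ x ≤ C) :
    ‖ξ‖ ≤ C :=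
  Real.iSup_le h hC

theorem PreL2.norm_nonneg' (ξ : PreL2 Γ X) : 0 ≤ ‖ξ‖ :=
  Real.iSup_nonneg fun _ => Real.sqrt_nonneg _

theorem PreL2.core [DiscreteTopology Γ] [CompactSpace X] : NormedSpace.Core ℂ (PreL2 Γ X) where
  norm_nonneg := PreL2.norm_nonneg'
  norm_smul c ξ := by
    have h : ∀ x, fibreNorm (c • ξ) x = ‖c‖ * fibreNorm ξ x := fun x => by
      simp only [fibreNorm, PreL2.smul_apply, norm_mul, mul_pow, tsum_mul_left]
      rw [Real.sqrt_mul (by positivity), Real.sqrt_sq (by positivity)]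
    simp only [PreL2.norm_def, h]
    rw [Real.mul_iSup_of_nonneg (by positivity)]
  norm_triangle ξ η :=
    PreL2.norm_le (add_nonneg (PreL2.norm_nonneg' _) (PreL2.norm_nonneg' _)) fun x =>
      (fibreNorm_add_le ξ η x).trans
        (add_le_add (fibreNorm_le_norm ξ x) (fibreNorm_le_norm η x))
  norm_eq_zero_iff ξ := by
    constructor
    · intro h
      obtain ⟨S, hS⟩ := exists_finset_support ξ
      refine CompactlySupportedContinuousMap.ext fun ⟨g, x⟩ => ?_
      change ξ (g, x) = 0
      by_cases hg : g ∈ S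
      · have h1 := fibreNorm_le_norm ξ x
        rw [h, fibreNorm_eq hS, Real.sqrt_le_left le_rfl] at h1
        have h2 : ‖ξ (g, x)‖ ^ 2 ≤ ∑ g ∈ S, ‖ξ (g, x)‖ ^ 2 :=
          Finset.single_le_sum (f := fun g => ‖ξ (g, x)‖ ^ 2) (fun _ _ => by positivity) hg
        have h3 : ‖ξ (g, x)‖ ^ 2 = 0 := le_antisymm (by simpa using h2.trans h1) (by positivity)
        simpa using h3
      · exact hS g hg x
    · rintro rfl
      have h : ∀ x, fibreNorm (0 : PreL2 Γ X) x = 0 := fun x => by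
        have : ∀ γ, (0 : PreL2 Γ X) γ = 0 := fun _ => rfl
        simp [fibreNorm, this]
      simp [PreL2.norm_def, h]

instance [DiscreteTopology Γ] [CompactSpace X] : NormedAddCommGroup (PreL2 Γ X) :=
  NormedAddCommGroup.ofCore PreL2.core

instance [DiscreteTopology Γ] [CompactSpace X] : NormedSpace ℂ (PreL2 Γ X) :=
  NormedSpace.ofCore PreL2.core

variable (Γ X) in
/-- The Hilbert `C(X)`-module `L²(Γ ⋉ X)`: the completion of `C_c (Γ ⋉ X)`. -/
abbrev L2 [DiscreteTopology Γ] [CompactSpace X] := UniformSpace.Completion (PreL2 Γ X)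

end

/-! ### The operators `λ(f)`, `M_ℓ` and `Δ^k(f)` -/

section

variable {Γ X : Type*} [Group Γ] [TopologicalSpace Γ] [DiscreteTopology Γ]
  [TopologicalSpace X] [CompactSpace X] [MulAction Γ X] [ContinuousConstSMul Γ X]

/-- The convolution `(f * ξ) γ = ∑_{β ∈ G_{s(γ)}} f (γ β⁻¹) ξ β`, where the source fibre of
`s(γ)` is `{(h, s(γ)) | h ∈ Γ}`. -/
def convFun (f ξ : TransformationGroupoid Γ X → ℂ) (γ : TransformationGroupoid Γ X) : ℂ :=
  ∑' h : Γ, f (mul γ (inv (h, src γ))) * ξ (h, src γ)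

theorem convFun_eq (f : TransformationGroupoid Γ X → ℂ) {ξ : TransformationGroupoid Γ X → ℂ}
    {S : Finset Γ} (hS : ∀ g ∉ S, ∀ x, ξ (g, x) = 0) (g : Γ) (x : X) :
    convFun f ξ (g, x) = ∑ h ∈ S, f (g * h⁻¹, h • x) * ξ (h, x) := by
  rw [convFun, tsum_eq_sum fun h hh => by simp [hS h hh, src]]
  rfl

theorem continuous_convFun (f : C_c(TransformationGroupoid Γ X, ℂ)) (ξ : PreL2 Γ X) : Continuous (convFun f ξ) := by
  obtain ⟨S, hS⟩ := exists_finset_support ξ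
  have : convFun f ξ = fun γ => ∑ h ∈ S, f (γ.1 * h⁻¹, h • γ.2) * ξ (h, γ.2) :=
    funext fun γ => convFun_eq f hS γ.1 γ.2
  rw [this]
  have h1 : Continuous f := f.continuous_toFun
  have h2 := ξ.continuous_coe
  have h3 : ∀ h : Γ, Continuous fun γ : Γ × X => γ.1 * h⁻¹ := fun h =>
    (continuous_of_discreteTopology (f := fun g : Γ => g * h⁻¹)).comp continuous_fst
  have h4 : ∀ h : Γ, Continuous fun γ : Γ × X => h • γ.2 := fun h =>
    (continuous_const_smul h).comp continuous_snd
  refine continuous_finsetSum _ fun h _ => ?_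
  exact (h1.comp ((h3 h).prodMk (h4 h))).mul (h2.comp (continuous_const.prodMk continuous_snd))

theorem hasCompactSupport_convFun (f : C_c(TransformationGroupoid Γ X, ℂ)) (ξ : PreL2 Γ X) :
    HasCompactSupport (convFun f ξ) := by
  classical
  obtain ⟨S, hS⟩ := exists_finset_support ξ
  obtain ⟨T, hT⟩ := exists_finset_supp f
  let K : Finset Γ := (T ×ˢ S).image fun p => p.1 * p.2
  refine (K.finite_toSet.isCompact.prod isCompact_univ).of_isClosed_subset
    (isClosed_tsupport _)
    (closure_minimal ?_ ((isClosed_discrete _).prod isClosed_univ))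
  rintro ⟨g, x⟩ hgx
  by_contra hK
  refine hgx ?_
  rw [convFun_eq f hS]
  refine Finset.sum_eq_zero fun h hh => ?_
  rw [hT _ _ _, zero_mul]
  intro hgh
  refine hK ⟨?_, Set.mem_univ _⟩
  simp only [K, Finset.coe_image, Set.mem_image, Finset.mem_coe, Finset.mem_product]
  exact ⟨(g * h⁻¹, h), ⟨hgh, hh⟩, by simp⟩

/-- The convolution product on `C_c (Γ ⋉ X)`. -/
def conv (f : C_c(TransformationGroupoid Γ X, ℂ)) (ξ : PreL2 Γ X) : PreL2 Γ X :=
  (⟨⟨convFun f ξ, continuous_convFun f ξ⟩, hasCompactSupport_convFun f ξ⟩ :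
    C_c(TransformationGroupoid Γ X, ℂ))

theorem conv_apply {f : C_c(TransformationGroupoid Γ X, ℂ)} {ξ : PreL2 Γ X} {S : Finset Γ} (hS : ∀ g ∉ S, ∀ x, ξ (g, x) = 0)
    (g : Γ) (x : X) :
    conv f ξ (g, x) = ∑ h ∈ S, f (g * h⁻¹, h • x) * ξ (h, x) :=
  convFun_eq f hS g x

/-- Left convolution by `f`, `ξ ↦ f * ξ`, on `C_c (Γ ⋉ X)`. -/
def lam (f : C_c(TransformationGroupoid Γ X, ℂ)) : Module.End ℂ (PreL2 Γ X) where
  toFun ξ := conv f ξ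
  map_add' ξ η := by
    classical
    obtain ⟨S, hS⟩ := exists_finset_support ξ
    obtain ⟨T, hT⟩ := exists_finset_support η
    have hS' : ∀ g ∉ S ∪ T, ∀ x, ξ (g, x) = 0 := fun g hg x => hS g (by grind) x
    have hT' : ∀ g ∉ S ∪ T, ∀ x, η (g, x) = 0 := fun g hg x => hT g (by grind) x
    have hST : ∀ g ∉ S ∪ T, ∀ x, (ξ + η) (g, x) = 0 := fun g hg x => by
      rw [PreL2.add_apply, hS' g hg, hT' g hg, add_zero]
    refine DFunLike.ext _ _ fun ⟨g, x⟩ => ?_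
    rw [PreL2.add_apply, conv_apply hS', conv_apply hT', conv_apply hST,
      ← Finset.sum_add_distrib]
    simp only [PreL2.add_apply, mul_add]
  map_smul' c ξ := by
    obtain ⟨S, hS⟩ := exists_finset_support ξ
    have hS' : ∀ g ∉ S, ∀ x, (c • ξ) (g, x) = 0 := fun g hg x => by
      rw [PreL2.smul_apply, hS g hg, mul_zero]
    refine DFunLike.ext _ _ fun ⟨g, x⟩ => ?_
    rw [RingHom.id_apply, PreL2.smul_apply, conv_apply hS, conv_apply hS', Finset.mul_sum]
    refine Finset.sum_congr rfl fun h _ => ?_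
    rw [PreL2.smul_apply]
    ring

/-- The operator `D = M_ℓ` of pointwise multiplication by `ℓ`, on its domain `C_c (Γ ⋉ X)`. -/
def mulOp (ℓ : LengthFunction Γ X) : Module.End ℂ (PreL2 Γ X) where
  toFun ξ := (⟨⟨fun γ => (ℓ γ : ℂ) * ξ γ,
      (Complex.continuous_ofReal.comp ℓ.continuous_toFun).mul ξ.continuous_coe⟩,
      HasCompactSupport.mul_left (CompactlySupportedContinuousMap.hasCompactSupport' ξ)⟩ :
    C_c(TransformationGroupoid Γ X, ℂ))
  map_add' ξ η := DFunLike.ext _ _ fun γ => mul_add (ℓ γ : ℂ) (ξ γ) (η γ)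
  map_smul' c ξ := DFunLike.ext _ _ fun γ => mul_left_comm (ℓ γ : ℂ) c (ξ γ)

theorem mulOp_apply (ℓ : LengthFunction Γ X) (ξ : PreL2 Γ X) (γ) :
    mulOp ℓ ξ γ = (ℓ γ : ℂ) * ξ γ := rfl

/-- The iterated commutators on `C_c (Γ ⋉ X)`: `Δ⁰(f) = λ(f)` and `Δ^{k+1}(f) = [D, Δ^k(f)]`. -/
def delta (ℓ : LengthFunction Γ X) (f : C_c(TransformationGroupoid Γ X, ℂ)) :
    ℕ → Module.End ℂ (PreL2 Γ X)
  | 0 => lam f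
  | k + 1 => mulOp ℓ * delta ℓ f k - delta ℓ f k * mulOp ℓ

theorem delta_apply (ℓ : LengthFunction Γ X) (f : C_c(TransformationGroupoid Γ X, ℂ)) (k : ℕ)
    {ξ : PreL2 Γ X} {S : Finset Γ} (hS : ∀ g ∉ S, ∀ x, ξ (g, x) = 0) (g : Γ) (x : X) :
    delta ℓ f k ξ (g, x) =
      ∑ h ∈ S, ((ℓ (g, x) : ℂ) - ℓ (h, x)) ^ k * f (g * h⁻¹, h • x) * ξ (h, x) := by
  induction k generalizing ξ with
  | zero =>
    simp only [pow_zero, one_mul]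
    exact conv_apply hS g x
  | succ k ih =>
    have hS' : ∀ g ∉ S, ∀ x, mulOp ℓ ξ (g, x) = 0 := fun g hg x => by
      rw [mulOp_apply, hS g hg, mul_zero]
    change (mulOp ℓ (delta ℓ f k ξ) - delta ℓ f k (mulOp ℓ ξ)) (g, x) = _
    rw [PreL2.sub_apply, mulOp_apply, ih hS, ih hS', Finset.mul_sum, ← Finset.sum_sub_distrib]
    refine Finset.sum_congr rfl fun h _ => ?_
    rw [mulOp_apply]
    ring

theorem LengthFunction.abs_sub_le (ℓ : LengthFunction Γ X) (g h : Γ) (x : X) :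
    |ℓ (g, x) - ℓ (h, x)| ≤ ℓ (g * h⁻¹, h • x) := by
  have h1 := ℓ.map_mul_le (g * h⁻¹, h • x) (h, x) rfl
  have h2 := ℓ.map_mul_le (inv (g * h⁻¹, h • x)) (g, x) (by simp [src, rng, inv, mul_smul])
  rw [ℓ.map_inv] at h2
  simp only [mul, inv, mul_inv_rev, inv_inv, mul_assoc, inv_mul_cancel,
    mul_one] at h1 h2
  rw [abs_le]
  constructor <;> linarith

/-- A kernel `c (g, h, x) f (g h⁻¹, h • x)` that is bounded defines an operator that is bounded for
the norm of `L²(Γ ⋉ X)`. -/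
theorem kernel_bound (f : C_c(TransformationGroupoid Γ X, ℂ)) (c : Γ → Γ → X → ℂ) (B : ℝ)
    (hB : ∀ g h x, ‖c g h x * f (g * h⁻¹, h • x)‖ ≤ B) :
    ∃ C : ℝ, ∀ ξ η : PreL2 Γ X, (∀ S : Finset Γ, (∀ g ∉ S, ∀ x, ξ (g, x) = 0) → ∀ g x,
      η (g, x) = ∑ h ∈ S, c g h x * f (g * h⁻¹, h • x) * ξ (h, x)) → ‖η‖ ≤ C * ‖ξ‖ := by
  classical
  obtain ⟨T, hT⟩ := exists_finset_supp f
  refine ⟨T.card * |B|, fun ξ η hη => ?_⟩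
  have hC : 0 ≤ T.card * |B| := by positivity
  refine PreL2.norm_le (mul_nonneg hC (norm_nonneg ξ)) fun x => ?_
  refine le_trans ?_ (mul_le_mul_of_nonneg_left (fibreNorm_le_norm ξ x) hC)
  obtain ⟨S, hS⟩ := exists_finset_support ξ
  obtain ⟨R, hR⟩ := exists_finset_support η
  have hpt : ∀ g, ‖η (g, x)‖ ≤ ∑ t ∈ T, |B| * ‖ξ (t⁻¹ * g, x)‖ := by
    intro g
    rw [hη S hS]
    calc _ ≤ ∑ h ∈ S, ‖c g h x * f (g * h⁻¹, h • x) * ξ (h, x)‖ :=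
          norm_sum_le _ _
      _ ≤ ∑ h ∈ S, if g * h⁻¹ ∈ T then |B| * ‖ξ (h, x)‖ else 0 := by
          refine Finset.sum_le_sum fun h _ => ?_
          split_ifs with hh
          · rw [norm_mul]
            exact mul_le_mul_of_nonneg_right ((hB g h x).trans (le_abs_self _)) (norm_nonneg _)
          · have : f (g * h⁻¹, h • x) = 0 := hT _ hh _
            simp [this]
      _ = ∑ h ∈ S with g * h⁻¹ ∈ T, |B| * ‖ξ (h, x)‖ := by rw [Finset.sum_filter]
      _ = ∑ t ∈ (S.filter fun h => g * h⁻¹ ∈ T).image (fun h => g * h⁻¹),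
            |B| * ‖ξ (t⁻¹ * g, x)‖ := by
          rw [Finset.sum_image fun a _ b _ hab => by simpa using hab]
          exact Finset.sum_congr rfl fun h _ => by simp
      _ ≤ _ := Finset.sum_le_sum_of_subset_of_nonneg
          (by intro t ht; simp only [Finset.mem_image, Finset.mem_filter] at ht; grind)
          fun _ _ _ => by positivity
  have htr : ∀ t ∈ T, ∑ g ∈ R, ‖ξ (t⁻¹ * g, x)‖ ^ 2 ≤ ∑ h ∈ S, ‖ξ (h, x)‖ ^ 2 := by
    intro t _
    calc _ = ∑ h ∈ R.image (fun g => t⁻¹ * g), ‖ξ (h, x)‖ ^ 2 := by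
          rw [Finset.sum_image fun a _ b _ hab => by simpa using hab]
      _ ≤ ∑ h ∈ R.image (fun g => t⁻¹ * g) ∪ S, ‖ξ (h, x)‖ ^ 2 :=
          Finset.sum_le_sum_of_subset_of_nonneg Finset.subset_union_left
            fun _ _ _ => by positivity
      _ = _ := (Finset.sum_subset Finset.subset_union_right
          fun h _ hh => by simp [hS h hh]).symm
  rw [fibreNorm_eq hR, fibreNorm_eq hS, ← Real.sqrt_sq hC, ← Real.sqrt_mul (sq_nonneg _)]
  refine Real.sqrt_le_sqrt ?_
  calc _ ≤ ∑ g ∈ R, (T.card : ℝ) * ∑ t ∈ T, (|B| * ‖ξ (t⁻¹ * g, x)‖) ^ 2 := by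
        refine Finset.sum_le_sum fun g _ => ?_
        exact (pow_le_pow_left₀ (norm_nonneg _) (hpt g) 2).trans sq_sum_le_card_mul_sum_sq
    _ = T.card * |B| ^ 2 * ∑ t ∈ T, ∑ g ∈ R, ‖ξ (t⁻¹ * g, x)‖ ^ 2 := by
        rw [Finset.sum_comm (s := T), ← Finset.mul_sum, mul_assoc]
        simp only [mul_pow, Finset.mul_sum]
    _ ≤ T.card * |B| ^ 2 * ∑ t ∈ T, ∑ h ∈ S, ‖ξ (h, x)‖ ^ 2 :=
        mul_le_mul_of_nonneg_left (Finset.sum_le_sum htr) (by positivity)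
    _ = _ := by rw [Finset.sum_const, nsmul_eq_mul]; ring

/-- Each `Δ^k(f)` is bounded for the norm of `L²(Γ ⋉ X)`. -/
theorem delta_bound (ℓ : LengthFunction Γ X) (f : C_c(TransformationGroupoid Γ X, ℂ)) (k : ℕ) :
    ∃ C : ℝ, ∀ ξ, ‖delta ℓ f k ξ‖ ≤ C * ‖ξ‖ := by
  obtain ⟨B, hB⟩ : ∃ B : ℝ, ∀ γ, ‖ℓ γ ^ k * ‖f γ‖‖ ≤ B := by
    have hc : Continuous fun γ => ℓ γ ^ k * ‖f γ‖ :=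
      (ℓ.continuous_toFun.pow k).mul f.continuous_toFun.norm
    exact hc.bounded_above_of_compact_support
      (HasCompactSupport.mul_left f.hasCompactSupport'.norm)
  obtain ⟨C, hC⟩ := kernel_bound f (fun g h x => ((ℓ (g, x) : ℂ) - ℓ (h, x)) ^ k) B
    fun g h x => by
      refine le_trans ?_ ((le_abs_self _).trans (hB (g * h⁻¹, h • x)))
      rw [norm_mul, norm_pow, ← Complex.ofReal_sub, Complex.norm_real]
      exact mul_le_mul_of_nonneg_right
        (pow_le_pow_left₀ (norm_nonneg _) (ℓ.abs_sub_le g h x) k) (norm_nonneg _)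
  exact ⟨C, fun ξ => hC ξ _ fun S hS g x => delta_apply ℓ f k hS g x⟩

/-- `λ(f)` is bounded for the norm of `L²(Γ ⋉ X)`. -/
theorem lam_bound (f : C_c(TransformationGroupoid Γ X, ℂ)) :
    ∃ C : ℝ, ∀ ξ, ‖lam f ξ‖ ≤ C * ‖ξ‖ := by
  obtain ⟨B, hB⟩ :=
    f.continuous_toFun.bounded_above_of_compact_support f.hasCompactSupport'
  obtain ⟨C, hC⟩ := kernel_bound f (fun _ _ _ => 1) B fun g h x => by
    rw [one_mul]
    exact hB (g * h⁻¹, h • x)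
  refine ⟨C, fun ξ => hC ξ _ fun S hS g x => ?_⟩
  simp only [one_mul]
  exact conv_apply hS g x

/-- The extension of `Δ^k(f)` to a bounded operator on `L²(Γ ⋉ X)`. -/
def deltaL2 (ℓ : LengthFunction Γ X) (f : C_c(TransformationGroupoid Γ X, ℂ)) (k : ℕ) :
    L2 Γ X →L[ℂ] L2 Γ X :=
  ((delta ℓ f k).mkContinuousOfExistsBound (delta_bound ℓ f k)).completion

/-- The seminorm `L^k_ℓ(f) = ‖Δ^k(f)‖` on `C_c (Γ ⋉ X)`; the norm of an adjointable operator on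
`L²(Γ ⋉ X)` is its operator norm. -/
def lipSeminorm (ℓ : LengthFunction Γ X) (k : ℕ) (f : C_c(TransformationGroupoid Γ X, ℂ)) : ℝ :=
  ‖deltaL2 ℓ f k‖

/-- The extension of `λ(f)` to a bounded operator on `L²(Γ ⋉ X)`. -/
def lamL2 (f : C_c(TransformationGroupoid Γ X, ℂ)) : L2 Γ X →L[ℂ] L2 Γ X :=
  ((lam f).mkContinuousOfExistsBound (lam_bound f)).completion

theorem lamL2_coe (f : C_c(TransformationGroupoid Γ X, ℂ)) (ξ : PreL2 Γ X) :
    lamL2 f (ξ : L2 Γ X) = (lam f ξ : L2 Γ X) :=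
  UniformSpace.Completion.map_coe (ContinuousLinearMap.uniformContinuous _) ξ

theorem deltaL2_coe (ℓ : LengthFunction Γ X) (f : C_c(TransformationGroupoid Γ X, ℂ)) (k : ℕ)
    (ξ : PreL2 Γ X) : deltaL2 ℓ f k (ξ : L2 Γ X) = (delta ℓ f k ξ : L2 Γ X) :=
  UniformSpace.Completion.map_coe (ContinuousLinearMap.uniformContinuous _) ξ

theorem lamL2_add (f f' : C_c(TransformationGroupoid Γ X, ℂ)) :
    lamL2 (f + f') = lamL2 f + lamL2 f' := by
  refine ContinuousLinearMap.ext fun v => ?_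
  induction v using UniformSpace.Completion.induction_on with
  | hp => exact isClosed_eq (ContinuousLinearMap.continuous _) (ContinuousLinearMap.continuous _)
  | ih ξ =>
    rw [add_apply, lamL2_coe, lamL2_coe, lamL2_coe,
      ← UniformSpace.Completion.coe_add]
    congr 1
    obtain ⟨S, hS⟩ := exists_finset_support ξ
    refine DFunLike.ext _ _ fun ⟨g, x⟩ => ?_
    change conv (f + f') ξ (g, x) = conv f ξ (g, x) + conv f' ξ (g, x)
    rw [conv_apply hS, conv_apply hS, conv_apply hS, ← Finset.sum_add_distrib]
    exact Finset.sum_congr rfl fun h _ => add_mul _ _ _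

/-- The representation `λ` of `C_c (Γ ⋉ X)` by bounded operators on `L²(Γ ⋉ X)`. -/
def lamHom : C_c(TransformationGroupoid Γ X, ℂ) →+ (L2 Γ X →L[ℂ] L2 Γ X) :=
  AddMonoidHom.mk' lamL2 lamL2_add

/-- The reduced norm `‖f‖_red = ‖λ(f)‖`. -/
def redNorm (f : C_c(TransformationGroupoid Γ X, ℂ)) : ℝ := ‖lamL2 f‖

end

/-! ### The reduced groupoid C*-algebra -/

section

variable (Γ X : Type*) [Group Γ] [TopologicalSpace Γ] [DiscreteTopology Γ]
  [TopologicalSpace X] [CompactSpace X] [MulAction Γ X] [ContinuousConstSMul Γ X]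

/-- The space `C_c (Γ ⋉ X)`, as a type that carries the reduced norm. -/
def PreReduced (Γ X : Type*) [Group Γ] [TopologicalSpace Γ] [TopologicalSpace X]
    [MulAction Γ X] := C_c(TransformationGroupoid Γ X, ℂ)

instance : AddCommGroup (PreReduced Γ X) :=
  inferInstanceAs (AddCommGroup C_c(TransformationGroupoid Γ X, ℂ))

instance : SeminormedAddCommGroup (PreReduced Γ X) :=
  SeminormedAddCommGroup.induced (PreReduced Γ X) (L2 Γ X →L[ℂ] L2 Γ X)
    (lamHom : C_c(TransformationGroupoid Γ X, ℂ) →+ (L2 Γ X →L[ℂ] L2 Γ X))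

/-- The reduced groupoid C*-algebra `C*_r(Γ ⋉ X)`, as a normed space: the completion of
`C_c (Γ ⋉ X)` with respect to the reduced norm. -/
abbrev ReducedCstar := UniformSpace.Completion (PreReduced Γ X)

variable {Γ X}

/-- The canonical map from `C_c (Γ ⋉ X)` to `C*_r(Γ ⋉ X)`. -/
def toReduced (f : C_c(TransformationGroupoid Γ X, ℂ)) : ReducedCstar Γ X :=
  UniformSpace.Completion.coe' (f : PreReduced Γ X)

theorem norm_toReduced (f : C_c(TransformationGroupoid Γ X, ℂ)) :
    ‖toReduced f‖ = redNorm f :=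
  UniformSpace.Completion.norm_coe _

end

/-! ### Rapid decay and the set `𝓛₁'` -/

section

variable {Γ X : Type*} [Group Γ] [TopologicalSpace Γ] [DiscreteTopology Γ]
  [TopologicalSpace X] [CompactSpace X] [MulAction Γ X] [ContinuousConstSMul Γ X]

/-- `‖f‖_{2,p,s,ℓ} = sup_x (∑_{γ ∈ G_x} |f γ|² (1 + ℓ γ)^{2p})^{1/2}`. -/
def sobolevNormS (ℓ : LengthFunction Γ X) (p : ℝ) (f : C_c(TransformationGroupoid Γ X, ℂ)) : ℝ :=
  ⨆ x : X, √(∑' g : Γ, ‖f (g, x)‖ ^ 2 * (1 + ℓ (g, x)) ^ (2 * p))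

/-- `‖f‖_{2,p,r,ℓ} = sup_x (∑_{γ ∈ G_x} |f γ⁻¹|² (1 + ℓ γ)^{2p})^{1/2}`. -/
def sobolevNormR (ℓ : LengthFunction Γ X) (p : ℝ) (f : C_c(TransformationGroupoid Γ X, ℂ)) : ℝ :=
  ⨆ x : X, √(∑' g : Γ, ‖f (inv (g, x))‖ ^ 2 * (1 + ℓ (g, x)) ^ (2 * p))

/-- `‖f‖_{2,p,ℓ}`. -/
def sobolevNorm (ℓ : LengthFunction Γ X) (p : ℝ) (f : C_c(TransformationGroupoid Γ X, ℂ)) : ℝ :=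
  max (sobolevNormS ℓ p f) (sobolevNormR ℓ p f)

/-- The rapid decay property of `Γ ⋉ X` with respect to `ℓ`. -/
def LengthFunction.HasRapidDecay (ℓ : LengthFunction Γ X) : Prop :=
  ∃ C p : ℝ, 0 < C ∧ 0 < p ∧
    ∀ f : C_c(TransformationGroupoid Γ X, ℂ), redNorm f ≤ C * sobolevNorm ℓ p f

/-- The set of all `f ∈ C_c (Γ ⋉ X)` with `L^k_ℓ(f) ≤ 1` that vanish on the unit space. -/
def lipBall (ℓ : LengthFunction Γ X) (k : ℕ) : Set C_c(TransformationGroupoid Γ X, ℂ) :=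
  {f | lipSeminorm ℓ k f ≤ 1 ∧ ∀ γ ∈ units Γ X, f γ = 0}

end

end

open scoped CompactlySupported
open TransformationGroupoid

noncomputable section

set_option linter.unusedSectionVars false

/-! Over a point `x`, the operator `Δ^k(f)` is the matrix with entries `(ℓ (g, x) - ℓ (h, x)) ^ k *
f (g * h⁻¹, h • x)`. Since `ℓ` vanishes on units, its column and its row at the unit are, up to
sign, `ℓ ^ k * f` along the source fibre and along the range fibre. Hence `L^k_ℓ(f)` dominates the
`ℓ²`-norms of `f` with weight `ℓ ^ k` on both kinds of fibre (`tsum_source_le`, `tsum_range_le`).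

Rapid decay only asks for the weight `(1 + ℓ) ^ p`. If `k` is an integer larger than `p`, the part
of `f` living where `ℓ > R` therefore has reduced norm tending to zero as `R` grows, uniformly over
`lipBall ℓ k` (`sobolevNorm_le_mul_lipSeminorm`, `weight_le_mul_pow`). When `X` is finite, hence
discrete, properness leaves only finitely many non-unit arrows with `ℓ ≤ R`, so the truncations of
all such `f` lie in a compact box of a finite-dimensional space.

Conversely, take `g ≠ 1`. On functions supported in the slice `{g} × X`, `L^k_ℓ` is at most a
constant times the supremum norm (`lipSeminorm_sliceFun_le`), while the reduced norm is at least the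
supremum norm (`norm_apply_le_redNorm`). So `lipBall ℓ k` contains a copy of a ball of `C(X)`, and
for infinite `X` Urysohn functions give arbitrarily large uniformly separated families in it. -/

variable {Γ X : Type*} [Group Γ] [TopologicalSpace Γ] [DiscreteTopology Γ]
  [TopologicalSpace X] [CompactSpace X] [MulAction Γ X] [ContinuousConstSMul Γ X]

/-! ### Functions on one slice and the unit vector -/

/-- A continuous function on `Γ ⋉ X` that lives on finitely many group elements, as an element of
`C_c (Γ ⋉ X)`. -/
def ofFinsetSupp (F : C(TransformationGroupoid Γ X, ℂ)) (S : Finset Γ)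
    (hS : ∀ g ∉ S, ∀ x, F (g, x) = 0) : C_c(TransformationGroupoid Γ X, ℂ) :=
  ⟨F, (S.finite_toSet.isCompact.prod isCompact_univ).of_isClosed_subset (isClosed_tsupport _)
    (closure_minimal (fun γ hγ => ⟨by_contra fun h => hγ (hS γ.1 h γ.2), Set.mem_univ _⟩)
      ((isClosed_discrete _).prod isClosed_univ))⟩

open Classical in
/-- The function `φ` placed on the slice `{g} × X`. -/
def sliceFun (g : Γ) (φ : C(X, ℂ)) : C_c(TransformationGroupoid Γ X, ℂ) :=
  ofFinsetSupp ⟨fun γ => (if γ.1 = g then 1 else 0) * φ γ.2,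
      ((continuous_of_discreteTopology (f := fun h : Γ => if h = g then (1 : ℂ) else 0)).comp
        continuous_fst).mul (φ.continuous.comp continuous_snd)⟩ {g}
    fun h hh x => by simp [Finset.notMem_singleton.1 hh]

theorem sliceFun_self (g : Γ) (φ : C(X, ℂ)) (x : X) : sliceFun g φ (g, x) = φ x := by
  classical
  change (if g = g then (1 : ℂ) else 0) * φ x = _
  simp

theorem sliceFun_of_ne {g h : Γ} (hg : h ≠ g) (φ : C(X, ℂ)) (x : X) :
    sliceFun g φ (h, x) = 0 := by
  classical
  change (if h = g then (1 : ℂ) else 0) * φ x = _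
  simp [hg]

theorem sliceFun_sub (g : Γ) (φ ψ : C(X, ℂ)) :
    sliceFun g φ - sliceFun g ψ = sliceFun g (φ - ψ) := by
  refine DFunLike.ext _ _ fun γ => ?_
  rw [CompactlySupportedContinuousMap.sub_apply]
  exact (mul_sub _ _ _).symm

variable (Γ X) in
/-- The indicator function of the unit space, as a vector of `L²`. -/
def unitVector : PreL2 Γ X := sliceFun 1 1

theorem unitVector_one (x : X) : unitVector Γ X (1, x) = 1 := sliceFun_self 1 1 x

theorem unitVector_of_notMem (g : Γ) (hg : g ∉ ({1} : Finset Γ)) (x : X) :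
    unitVector Γ X (g, x) = 0 :=
  sliceFun_of_ne (Finset.notMem_singleton.1 hg) 1 x

theorem norm_unitVector_le : ‖unitVector Γ X‖ ≤ 1 :=
  PreL2.norm_le zero_le_one fun x => by
    rw [fibreNorm_eq unitVector_of_notMem, Finset.sum_singleton, unitVector_one]
    simp

/-! ### Passing between `C_c` and the completed operators -/

theorem norm_delta_le (ℓ : LengthFunction Γ X) (f : C_c(TransformationGroupoid Γ X, ℂ)) (k : ℕ)
    (ξ : PreL2 Γ X) : ‖delta ℓ f k ξ‖ ≤ lipSeminorm ℓ k f * ‖ξ‖ := by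
  have h := (deltaL2 ℓ f k).le_opNorm (ξ : L2 Γ X)
  rwa [deltaL2_coe, UniformSpace.Completion.norm_coe, UniformSpace.Completion.norm_coe] at h

theorem norm_lam_le (f : C_c(TransformationGroupoid Γ X, ℂ)) (ξ : PreL2 Γ X) :
    ‖lam f ξ‖ ≤ redNorm f * ‖ξ‖ := by
  have h := (lamL2 f).le_opNorm (ξ : L2 Γ X)
  rwa [lamL2_coe, UniformSpace.Completion.norm_coe, UniformSpace.Completion.norm_coe] at h

theorem lipSeminorm_le {ℓ : LengthFunction Γ X} {f : C_c(TransformationGroupoid Γ X, ℂ)} {k : ℕ}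
    {C : ℝ} (hC : 0 ≤ C) (h : ∀ ξ : PreL2 Γ X, ‖delta ℓ f k ξ‖ ≤ C * ‖ξ‖) :
    lipSeminorm ℓ k f ≤ C := by
  refine ContinuousLinearMap.opNorm_le_bound _ hC fun v => ?_
  induction v using UniformSpace.Completion.induction_on with
  | hp => exact isClosed_le (by fun_prop) (by fun_prop)
  | ih ξ =>
    rw [deltaL2_coe, UniformSpace.Completion.norm_coe, UniformSpace.Completion.norm_coe]
    exact h ξ

theorem norm_apply_le_fibreNorm (ξ : PreL2 Γ X) (g : Γ) (x : X) : ‖ξ (g, x)‖ ≤ fibreNorm ξ x := by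
  obtain ⟨S, hS⟩ := exists_finset_support ξ
  rw [fibreNorm_eq hS]
  by_cases hg : g ∈ S
  · exact Real.le_sqrt_of_sq_le
      (Finset.single_le_sum (f := fun g => ‖ξ (g, x)‖ ^ 2) (fun _ _ => by positivity) hg)
  · rw [hS g hg, norm_zero]
    positivity

theorem fibreNorm_sq (ξ : PreL2 Γ X) (x : X) : fibreNorm ξ x ^ 2 = ∑' g : Γ, ‖ξ (g, x)‖ ^ 2 :=
  Real.sq_sqrt (tsum_nonneg fun _ => by positivity)

theorem LengthFunction.apply_one (ℓ : LengthFunction Γ X) (x : X) : ℓ (1, x) = 0 :=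
  (ℓ.eq_zero_iff (1, x)).2 rfl

/-! ### Weighted fibre norms from the columns and rows of `Δ^k(f)` -/

/-- The commutators control the weighted `ℓ²`-norms on source fibres. -/
theorem tsum_source_le (ℓ : LengthFunction Γ X) (f : C_c(TransformationGroupoid Γ X, ℂ)) (k : ℕ)
    (x : X) : ∑' g : Γ, ‖f (g, x)‖ ^ 2 * ℓ (g, x) ^ (2 * k) ≤ lipSeminorm ℓ k f ^ 2 := by
  have hval : ∀ g, delta ℓ f k (unitVector Γ X) (g, x) = (ℓ (g, x) : ℂ) ^ k * f (g, x) := fun g => by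
    rw [delta_apply ℓ f k unitVector_of_notMem, Finset.sum_singleton, unitVector_one,
      ℓ.apply_one]
    simp
  have h1 : fibreNorm (delta ℓ f k (unitVector Γ X)) x ≤ lipSeminorm ℓ k f :=
    (fibreNorm_le_norm _ x).trans <| (norm_delta_le ℓ f k _).trans <|
      mul_le_of_le_one_right (norm_nonneg _) norm_unitVector_le
  have h2 := pow_le_pow_left₀ (Real.sqrt_nonneg _) h1 2
  change fibreNorm _ x ^ 2 ≤ _ at h2
  rw [fibreNorm_sq] at h2
  refine le_of_eq_of_le (tsum_congr fun g => ?_) h2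
  rw [hval, norm_mul, norm_pow, Complex.norm_real, Real.norm_eq_abs, mul_pow, ← pow_mul,
    mul_comm k 2, (even_two_mul k).pow_abs, mul_comm]

theorem continuous_inv_arrow :
    Continuous (TransformationGroupoid.inv : TransformationGroupoid Γ X → _) := by
  have h : Continuous fun γ : Γ × X => γ.1 • γ.2 :=
    continuous_prod_of_discrete_left.2 fun g => continuous_const_smul g
  exact ((continuous_of_discreteTopology (f := fun g : Γ => g⁻¹)).comp continuous_fst).prodMk h

/-- The commutators control the weighted `ℓ²`-norms on range fibres. -/
theorem tsum_range_le (ℓ : LengthFunction Γ X) (f : C_c(TransformationGroupoid Γ X, ℂ)) (k : ℕ)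
    (x : X) : ∑' g : Γ, ‖f (inv (g, x))‖ ^ 2 * ℓ (g, x) ^ (2 * k) ≤ lipSeminorm ℓ k f ^ 2 := by
  classical
  obtain ⟨S, hS⟩ := exists_finset_supp f
  have hsupp : ∀ g ∉ S.image (·⁻¹), ∀ x, star ((-(ℓ (g, x) : ℂ)) ^ k * f (inv (g, x))) = 0 := by
    intro g hg x
    rw [inv, hS, mul_zero, star_zero]
    exact fun h => hg (Finset.mem_image.2 ⟨g⁻¹, h, inv_inv g⟩)
  -- `ξ` is the complex conjugate of the row of `Δ^k(f)` at the unit, so that pairing the row with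
  -- `ξ` returns the squared fibre norm of `ξ` itself.
  let ξ : PreL2 Γ X := ofFinsetSupp ⟨fun γ => star ((-(ℓ γ : ℂ)) ^ k * f (inv γ)),
    ((((Complex.continuous_ofReal.comp ℓ.continuous_toFun).neg).pow k).mul
      (f.continuous_toFun.comp continuous_inv_arrow)).star⟩ _ hsupp
  have hξ : ∀ γ, ξ γ = star ((-(ℓ γ : ℂ)) ^ k * f (inv γ)) := fun _ => rfl
  have hξS : ∀ g ∉ S.image (·⁻¹), ∀ x, ξ (g, x) = 0 := hsupp
  have hval : ∀ y, ‖delta ℓ f k ξ (1, y)‖ = fibreNorm ξ y ^ 2 := fun y => by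
    rw [delta_apply ℓ f k hξS, fibreNorm_eq hξS,
      Real.sq_sqrt (Finset.sum_nonneg fun _ _ => by positivity)]
    have : ∀ h : Γ, ((ℓ (1, y) : ℂ) - ℓ (h, y)) ^ k * f (1 * h⁻¹, h • y) * ξ (h, y) =
        ((‖ξ (h, y)‖ ^ 2 : ℝ) : ℂ) := fun h => by
      rw [hξ, ℓ.apply_one, one_mul, Complex.ofReal_zero, zero_sub, norm_star, Complex.star_def]
      push_cast
      exact Complex.mul_conj' _
    rw [Finset.sum_congr rfl fun h _ => this h, ← Complex.ofReal_sum, Complex.norm_real,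
      Real.norm_of_nonneg (Finset.sum_nonneg fun _ _ => by positivity)]
  have hL : 0 ≤ lipSeminorm ℓ k f := norm_nonneg _
  have hsq : ∀ y, fibreNorm ξ y ^ 2 ≤ lipSeminorm ℓ k f * ‖ξ‖ := fun y => by
    rw [← hval]
    exact (norm_apply_le_fibreNorm _ 1 y).trans
      ((fibreNorm_le_norm _ y).trans (norm_delta_le ℓ f k ξ))
  -- Taking suprema in `hsq` gives `‖ξ‖ ^ 2 ≤ L * ‖ξ‖` with `L = lipSeminorm ℓ k f`; one factor
  -- `‖ξ‖` is then cancelled.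
  have hnorm : ‖ξ‖ ≤ lipSeminorm ℓ k f := by
    have h1 : ‖ξ‖ ≤ √(lipSeminorm ℓ k f * ‖ξ‖) :=
      PreL2.norm_le (Real.sqrt_nonneg _) fun y => Real.le_sqrt_of_sq_le (hsq y)
    have h2 := (Real.le_sqrt' (x := ‖ξ‖) (y := lipSeminorm ℓ k f * ‖ξ‖))
    rcases (norm_nonneg ξ).eq_or_lt with h0 | h0
    · rwa [← h0]
    · have := (h2 h0).1 h1
      nlinarith
  have h := (hsq x).trans (mul_le_mul_of_nonneg_left hnorm hL)
  rw [fibreNorm_sq, ← sq] at h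
  refine le_of_eq_of_le (tsum_congr fun g => ?_) h
  rw [hξ, norm_star, norm_mul, norm_pow, norm_neg, Complex.norm_real, Real.norm_eq_abs, mul_pow,
    ← pow_mul, mul_comm k 2, (even_two_mul k).pow_abs, mul_comm]

/-! ### Slices: comparison with the supremum norm -/

/-- On functions living on one slice, the seminorm `L^k_ℓ` is dominated by the supremum norm. -/
theorem lipSeminorm_sliceFun_le (ℓ : LengthFunction Γ X) (k : ℕ) (g : Γ) {B M : ℝ}
    (hB : ∀ x, ℓ (g, x) ≤ B) (hB0 : 0 ≤ B) (φ : C(X, ℂ)) (hM0 : 0 ≤ M) (hM : ∀ x, ‖φ x‖ ≤ M) :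
    lipSeminorm ℓ k (sliceFun g φ) ≤ B ^ k * M := by
  classical
  have hC : 0 ≤ B ^ k * M := by positivity
  refine lipSeminorm_le hC fun ξ => PreL2.norm_le (by positivity) fun x => ?_
  refine le_trans ?_ (mul_le_mul_of_nonneg_left (fibreNorm_le_norm ξ x) hC)
  obtain ⟨S, hS⟩ := exists_finset_support ξ
  have hpt : ∀ t, ‖delta ℓ (sliceFun g φ) k ξ (t, x)‖ ≤ B ^ k * M * ‖ξ (g⁻¹ * t, x)‖ := by
    intro t
    -- The symbol lives on the slice of `g`, so the matrix is a weighted translation: only `h = g⁻¹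
    -- * t` satisfies `t * h⁻¹ = g`.
    rw [delta_apply ℓ _ k hS, Finset.sum_eq_single (g⁻¹ * t)]
    · have hl := ℓ.abs_sub_le t (g⁻¹ * t) x
      have hg : t * (g⁻¹ * t)⁻¹ = g := by group
      rw [hg] at hl ⊢
      rw [sliceFun_self, norm_mul, norm_mul, norm_pow, ← Complex.ofReal_sub, Complex.norm_real,
        Real.norm_eq_abs]
      gcongr
      · exact hl.trans (hB _)
      · exact hM _
    · intro h _ hh
      rw [sliceFun_of_ne, mul_zero, zero_mul]
      rintro rfl
      exact hh (by group)
    · intro h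
      rw [hS _ h, mul_zero]
  have hs : Summable fun t => (B ^ k * M * ‖ξ (g⁻¹ * t, x)‖) ^ 2 := by
    refine summable_of_ne_finset_zero (s := S.image (g * ·)) fun t ht => ?_
    have : g⁻¹ * t ∉ S := fun hm => ht (Finset.mem_image.2 ⟨_, hm, mul_inv_cancel_left g t⟩)
    simp [hS _ this]
  have hs' : Summable fun t => ‖delta ℓ (sliceFun g φ) k ξ (t, x)‖ ^ 2 :=
    hs.of_nonneg_of_le (fun _ => by positivity) fun t =>
      pow_le_pow_left₀ (norm_nonneg _) (hpt t) 2
  refine Real.sqrt_le_iff.2 ⟨mul_nonneg hC (Real.sqrt_nonneg _), ?_⟩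
  rw [mul_pow, fibreNorm_sq, ← tsum_mul_left,
    ← (Equiv.mulLeft g⁻¹).tsum_eq (fun h => (B ^ k * M) ^ 2 * ‖ξ (h, x)‖ ^ 2)]
  refine (hs'.tsum_le_tsum (fun t => pow_le_pow_left₀ (norm_nonneg _) (hpt t) 2) hs).trans_eq ?_
  exact tsum_congr fun t => mul_pow _ _ _

/-- The reduced norm dominates the supremum norm. -/
theorem norm_apply_le_redNorm (f : C_c(TransformationGroupoid Γ X, ℂ)) (g : Γ) (x : X) :
    ‖f (g, x)‖ ≤ redNorm f := by
  -- The indicator of the unit space is a unit for convolution, so `f` itself is the image of a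
  -- vector of norm at most one.
  have hval : lam f (unitVector Γ X) (g, x) = f (g, x) := by
    change conv f _ (g, x) = _
    rw [conv_apply unitVector_of_notMem, Finset.sum_singleton, unitVector_one]
    simp
  rw [← hval]
  exact (norm_apply_le_fibreNorm _ g x).trans <| (fibreNorm_le_norm _ x).trans <|
    (norm_lam_le f _).trans <| mul_le_of_le_one_right (norm_nonneg _) norm_unitVector_le

theorem dist_toReduced (f f' : C_c(TransformationGroupoid Γ X, ℂ)) :
    dist (toReduced f) (toReduced f') = redNorm (f - f') := by
  rw [← norm_toReduced, dist_eq_norm]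
  congr 1
  exact (UniformSpace.Completion.coe_sub (α := PreReduced Γ X) f f').symm

theorem LengthFunction.exists_slice_bound (ℓ : LengthFunction Γ X) (g : Γ) :
    ∃ B : ℝ, 0 < B ∧ ∀ x, ℓ (g, x) ≤ B := by
  have hc : Continuous fun x : X => ℓ (g, x) :=
    ℓ.continuous_toFun.comp (continuous_const.prodMk continuous_id)
  obtain ⟨B, hB⟩ := (isCompact_range hc).bddAbove
  exact ⟨max B 1, by positivity, fun x => (hB ⟨x, rfl⟩).trans (le_max_left _ _)⟩

/-! ### Total boundedness forces `X` to be finite -/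

/-- Pigeonhole: on an infinite `X` there are more bump functions at mutual distance at least `r`
than balls of radius `r / 2` in a given finite cover. -/
theorem finite_of_totallyBounded_lipBall [Nontrivial Γ] [T2Space X] (ℓ : LengthFunction Γ X)
    (k : ℕ) (h : TotallyBounded (toReduced '' lipBall ℓ k)) : Finite X := by
  classical
  by_contra hX
  rw [not_finite_iff_infinite] at hX
  obtain ⟨g, hg⟩ := exists_ne (1 : Γ)
  obtain ⟨B, hB0, hB⟩ := ℓ.exists_slice_bound g
  -- A function of supremum norm at most `r` on the slice of `g` has `L^k_ℓ` at most `B ^ k * r =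
  -- 1`.
  set r : ℝ := (B ^ k)⁻¹
  have hr : 0 < r := by positivity
  obtain ⟨t, ht, hcover⟩ := Metric.totallyBounded_iff.1 h (r / 2) (by positivity)
  obtain ⟨P, hP⟩ := Infinite.exists_subset_card_eq X (ht.toFinset.card + 1)
  -- Urysohn's lemma separates `x` from the rest of the finite set `P`. For distinct `x, y ∈ P`, the
  -- difference of the two bumps then has modulus `r` at `x`.
  have hbump : ∀ x : X, ∃ φ : C(X, ℂ), φ x = r ∧ (∀ y ∈ P, y ≠ x → φ y = 0) ∧ ∀ y, ‖φ y‖ ≤ r := by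
    intro x
    obtain ⟨u, hu0, hu1, hu⟩ := exists_continuous_zero_one_of_isClosed
      (P.erase x).finite_toSet.isClosed (isClosed_singleton (x := x))
      (Set.disjoint_singleton_right.2 (by simp))
    refine ⟨⟨fun y => ((r * u y : ℝ) : ℂ), by fun_prop⟩, ?_, fun y hy hyx => ?_, fun y => ?_⟩
    · simp [hu1 (Set.mem_singleton x)]
    · simp [hu0 (Finset.mem_coe.2 (Finset.mem_erase.2 ⟨hyx, hy⟩))]
    · rw [ContinuousMap.coe_mk, Complex.norm_real,
        Real.norm_of_nonneg (mul_nonneg hr.le (hu y).1)]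
      exact mul_le_of_le_one_right hr.le (hu y).2
  choose φ hφ1 hφ0 hφ using hbump
  have hmem : ∀ x, sliceFun g (φ x) ∈ lipBall ℓ k := fun x => by
    refine ⟨(lipSeminorm_sliceFun_le ℓ k g hB hB0.le (φ x) hr.le (hφ x)).trans_eq
      (mul_inv_cancel₀ (by positivity)), ?_⟩
    rintro ⟨a, y⟩ (rfl : a = 1)
    exact sliceFun_of_ne hg.symm _ y
  have hnear : ∀ x, ∃ y ∈ t, dist (toReduced (sliceFun g (φ x))) y < r / 2 := fun x => by
    simpa using hcover (Set.mem_image_of_mem toReduced (hmem x))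
  choose c hct hc using hnear
  obtain ⟨x, hx, y, hy, hxy, hcxy⟩ := Finset.exists_ne_map_eq_of_card_lt_of_maps_to
    (s := P) (t := ht.toFinset) (f := c) (by omega) fun x _ => by simpa using hct x
  have hd : dist (toReduced (sliceFun g (φ x))) (toReduced (sliceFun g (φ y))) < r := by
    have h1 := hc x
    have h2 := hc y
    rw [← hcxy] at h2
    linarith [dist_triangle_right (toReduced (sliceFun g (φ x))) (toReduced (sliceFun g (φ y)))
      (c x)]
  rw [dist_toReduced, sliceFun_sub] at hd
  have h3 := norm_apply_le_redNorm (sliceFun g (φ x - φ y)) g x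
  rw [sliceFun_self, ContinuousMap.sub_apply, hφ1, hφ0 y x hx hxy, sub_zero, Complex.norm_real,
    Real.norm_of_nonneg hr.le] at h3
  linarith

/-! ### Estimates of the Sobolev norm -/

theorem sobolevNorm_le {ℓ : LengthFunction Γ X} {p A : ℝ}
    {f : C_c(TransformationGroupoid Γ X, ℂ)} (hA : 0 ≤ A)
    (hs : ∀ x, ∑' g : Γ, ‖f (g, x)‖ ^ 2 * (1 + ℓ (g, x)) ^ (2 * p) ≤ A ^ 2)
    (hr : ∀ x, ∑' g : Γ, ‖f (inv (g, x))‖ ^ 2 * (1 + ℓ (g, x)) ^ (2 * p) ≤ A ^ 2) :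
    sobolevNorm ℓ p f ≤ A :=
  max_le (Real.iSup_le (fun x => Real.sqrt_le_iff.2 ⟨hA, hs x⟩) hA)
    (Real.iSup_le (fun x => Real.sqrt_le_iff.2 ⟨hA, hr x⟩) hA)

theorem summable_source (f : C_c(TransformationGroupoid Γ X, ℂ)) (w : Γ → ℝ) (x : X) :
    Summable fun g : Γ => ‖f (g, x)‖ ^ 2 * w g := by
  obtain ⟨S, hS⟩ := exists_finset_supp f
  refine summable_of_ne_finset_zero (s := S) fun g hg => ?_
  simp [hS g hg]

theorem summable_range (f : C_c(TransformationGroupoid Γ X, ℂ)) (w : Γ → ℝ) (x : X) :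
    Summable fun g : Γ => ‖f (inv (g, x))‖ ^ 2 * w g := by
  classical
  obtain ⟨S, hS⟩ := exists_finset_supp f
  refine summable_of_ne_finset_zero (s := S.image (·⁻¹)) fun g hg => ?_
  have : g⁻¹ ∉ S := fun h => hg (Finset.mem_image.2 ⟨g⁻¹, h, inv_inv g⟩)
  simp [inv, hS _ this]

theorem LengthFunction.weight_nonneg (ℓ : LengthFunction Γ X) (q : ℝ) (γ) : 0 ≤ (1 + ℓ γ) ^ q :=
  Real.rpow_nonneg (add_nonneg zero_le_one (ℓ.nonneg γ)) q

/-- If the weight `(1 + ℓ)^{2p}` is at most `η² ℓ^{2k}` on the support of `u`, and `u` is dominated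
by `f`, then the Sobolev norm of `u` is at most `η L^k_ℓ(f)`. -/
theorem sobolevNorm_le_mul_lipSeminorm {ℓ : LengthFunction Γ X} {p η : ℝ} {k : ℕ} (hη : 0 ≤ η)
    {f u : C_c(TransformationGroupoid Γ X, ℂ)}
    (hu : ∀ γ, ‖u γ‖ ^ 2 * (1 + ℓ γ) ^ (2 * p) ≤ η ^ 2 * (‖f γ‖ ^ 2 * ℓ γ ^ (2 * k))) :
    sobolevNorm ℓ p u ≤ η * lipSeminorm ℓ k f := by
  refine sobolevNorm_le (mul_nonneg hη (norm_nonneg _)) (fun x => ?_) fun x => ?_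
  · rw [mul_pow]
    refine le_trans ?_ (mul_le_mul_of_nonneg_left (tsum_source_le ℓ f k x) (sq_nonneg η))
    rw [← tsum_mul_left]
    exact (summable_source u _ x).tsum_le_tsum (fun g => hu (g, x))
      ((summable_source f _ x).mul_left _)
  · rw [mul_pow]
    refine le_trans ?_ (mul_le_mul_of_nonneg_left (tsum_range_le ℓ f k x) (sq_nonneg η))
    rw [← tsum_mul_left]
    refine (summable_range u _ x).tsum_le_tsum (fun g => ?_) ((summable_range f _ x).mul_left _)
    have h := hu (inv (g, x))
    rwa [show ℓ (inv (g, x)) = ℓ (g, x) from ℓ.map_inv (g, x)] at h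

theorem inv_arrow_injective (x : X) : Function.Injective fun g : Γ => inv (g, x) :=
  fun _ _ h => inv_injective (congrArg Prod.fst h)

/-- The Sobolev norm of a function bounded by `δ` on a finite set of arrows and zero elsewhere. -/
theorem sobolevNorm_le_of_finset {ℓ : LengthFunction Γ X} {p δ : ℝ} (hδ : 0 ≤ δ)
    (F : Finset (TransformationGroupoid Γ X)) {u : C_c(TransformationGroupoid Γ X, ℂ)}
    (hF : ∀ γ ∉ F, u γ = 0) (hu : ∀ γ, ‖u γ‖ ≤ δ) :
    sobolevNorm ℓ p u ≤ √(∑ γ ∈ F, (1 + ℓ γ) ^ (2 * p)) * δ := by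
  have hw : ∀ γ, 0 ≤ (1 + ℓ γ) ^ (2 * p) := ℓ.weight_nonneg (2 * p)
  have h0 : ∀ γ ∉ F, ‖u γ‖ ^ 2 * (1 + ℓ γ) ^ (2 * p) = 0 := fun γ hγ => by simp [hF γ hγ]
  -- Source fibres and range fibres are both injective images of `Γ` in the set of arrows, so the
  -- total sum over `F` bounds every fibre sum of either kind.
  have key : ∀ j : Γ → TransformationGroupoid Γ X, Function.Injective j →
      ∑' g, ‖u (j g)‖ ^ 2 * (1 + ℓ (j g)) ^ (2 * p) ≤
        (√(∑ γ ∈ F, (1 + ℓ γ) ^ (2 * p)) * δ) ^ 2 := fun j hj => by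
    rw [mul_pow, Real.sq_sqrt (Finset.sum_nonneg fun γ _ => hw γ), Finset.sum_mul]
    refine (tsum_comp_le_tsum_of_inj (summable_of_ne_finset_zero h0)
      (fun γ => mul_nonneg (sq_nonneg _) (hw γ)) hj).trans ?_
    rw [tsum_eq_sum h0]
    refine Finset.sum_le_sum fun γ _ => ?_
    rw [mul_comm]
    exact mul_le_mul_of_nonneg_left (pow_le_pow_left₀ (norm_nonneg _) (hu γ) 2) (hw γ)
  refine sobolevNorm_le (by positivity)
    (fun x => key (fun g => (g, x)) fun _ _ h => congrArg Prod.fst h) fun x => ?_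
  refine le_of_eq_of_le (tsum_congr fun g => ?_) (key _ (inv_arrow_injective x))
  rw [show ℓ (inv (g, x)) = ℓ (g, x) from ℓ.map_inv (g, x)]

/-! ### Truncation to finitely many arrows -/

open Classical in
/-- A function on a finite set of arrows, extended by zero, when the unit space is discrete. -/
def extendZero [DiscreteTopology X] (F : Finset (TransformationGroupoid Γ X)) (a : F → ℂ) :
    C_c(TransformationGroupoid Γ X, ℂ) :=
  ofFinsetSupp ⟨fun γ => if h : γ ∈ F then a ⟨γ, h⟩ else 0, continuous_of_discreteTopology⟩
    (F.image Prod.fst) fun _ hg _ =>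
      dif_neg fun h => hg (Finset.mem_image_of_mem Prod.fst h)

theorem extendZero_of_mem [DiscreteTopology X] {F : Finset (TransformationGroupoid Γ X)}
    (a : F → ℂ) {γ} (h : γ ∈ F) : extendZero F a γ = a ⟨γ, h⟩ := by
  classical exact dif_pos h

theorem extendZero_of_notMem [DiscreteTopology X] {F : Finset (TransformationGroupoid Γ X)}
    (a : F → ℂ) {γ} (h : γ ∉ F) : extendZero F a γ = 0 := by
  classical exact dif_neg h

/-- Rapid decay bounds the reduced norm by the Sobolev norm, which on functions supported in `F` is
at most a constant times the supremum norm. The map is thus Lipschitz and carries compact boxes to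
totally bounded sets. -/
theorem uniformContinuous_extendZero [DiscreteTopology X] {ℓ : LengthFunction Γ X}
    (hdecay : ℓ.HasRapidDecay) (F : Finset (TransformationGroupoid Γ X)) :
    UniformContinuous fun a : F → ℂ => toReduced (extendZero F a) := by
  obtain ⟨C, p, hC, -, hrd⟩ := hdecay
  refine (LipschitzWith.of_dist_le' (K := C * √(∑ γ ∈ F, (1 + ℓ γ) ^ (2 * p)))
    fun a b => ?_).uniformContinuous
  rw [dist_toReduced, mul_assoc]
  refine (hrd _).trans (mul_le_mul_of_nonneg_left ?_ hC.le)
  refine sobolevNorm_le_of_finset dist_nonneg F (fun γ hγ => ?_) fun γ => ?_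
  · simp [extendZero_of_notMem _ hγ]
  · rw [CompactlySupportedContinuousMap.sub_apply]
    by_cases hγ : γ ∈ F
    · rw [extendZero_of_mem a hγ, extendZero_of_mem b hγ, ← dist_eq_norm]
      exact dist_le_pi_dist a b ⟨γ, hγ⟩
    · simp [extendZero_of_notMem _ hγ]

/-- For `t ≥ 1` one has `1 + t ≤ 2 * t`, which costs the factor `4 ^ m`. The exponent `m + 1` in
place of `m` leaves a spare `t ^ 2 ≥ t` that absorbs `4 ^ m / η`. -/
theorem weight_le_mul_pow {p η t : ℝ} {m : ℕ} (hp : p ≤ m) (hη : 0 < η) (h1 : 1 ≤ t)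
    (ht : 4 ^ m / η ≤ t) : (1 + t) ^ (2 * p) ≤ η * t ^ (2 * (m + 1)) := by
  calc (1 + t) ^ (2 * p) ≤ (1 + t) ^ ((2 * m : ℕ) : ℝ) :=
        Real.rpow_le_rpow_of_exponent_le (by linarith) (by push_cast; linarith)
    _ = (1 + t) ^ (2 * m) := Real.rpow_natCast _ _
    _ ≤ (2 * t) ^ (2 * m) := pow_le_pow_left₀ (by linarith) (by linarith) _
    _ = 4 ^ m * t ^ (2 * m) := by rw [mul_pow, pow_mul 2]; norm_num
    _ ≤ (η * t ^ 2) * t ^ (2 * m) := by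
        refine mul_le_mul_of_nonneg_right ?_ (by positivity)
        rw [div_le_iff₀' hη] at ht
        exact ht.trans (mul_le_mul_of_nonneg_left (by nlinarith) hη.le)
    _ = η * t ^ (2 * (m + 1)) := by ring

theorem LengthFunction.IsProper.finite_setOf_le [DiscreteTopology X] {ℓ : LengthFunction Γ X}
    (hproper : ℓ.IsProper) (R : ℝ) : {γ | γ ∉ units Γ X ∧ ℓ γ ≤ R}.Finite :=
  ((hproper _ (fun _ h => h.1) ⟨R, by rintro _ ⟨γ, h, rfl⟩; exact h.2⟩).finite_of_discrete).subset
    subset_closure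

/-- A single term of the sum in `tsum_source_le` is at most the whole sum, and `ℓ` is positive off
the units. These bounds give the sides of the box that contains all truncations. -/
theorem norm_apply_le_of_mem_lipBall {ℓ : LengthFunction Γ X} {k : ℕ}
    {f : C_c(TransformationGroupoid Γ X, ℂ)} (hf : f ∈ lipBall ℓ k) {γ}
    (hγ : γ ∉ units Γ X) : ‖f γ‖ ≤ (ℓ γ ^ k)⁻¹ := by
  obtain ⟨g, x⟩ := γ
  have hpos : 0 < ℓ (g, x) :=
    (ℓ.nonneg _).lt_of_ne fun h => hγ ((ℓ.eq_zero_iff _).1 h.symm)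
  have h1 : ‖f (g, x)‖ ^ 2 * ℓ (g, x) ^ (2 * k) ≤ 1 :=
    ((summable_source f (fun g => ℓ (g, x) ^ (2 * k)) x).le_tsum g fun h _ =>
      mul_nonneg (sq_nonneg _) (pow_nonneg (ℓ.nonneg _) _)).trans
      ((tsum_source_le ℓ f k x).trans (pow_le_one₀ (norm_nonneg _) hf.1))
  rw [mul_comm 2 k, pow_mul, ← mul_pow] at h1
  rw [← one_div, le_div_iff₀ (pow_pos hpos k)]
  exact (sq_le_one_iff₀ (mul_nonneg (norm_nonneg _) (pow_nonneg hpos.le _))).1 h1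

/-! ### Total boundedness over a discrete unit space -/

theorem exists_totallyBounded_lipBall [DiscreteTopology X] (ℓ : LengthFunction Γ X)
    (hproper : ℓ.IsProper) (hdecay : ℓ.HasRapidDecay) :
    ∃ k : ℕ, 1 ≤ k ∧ TotallyBounded (toReduced '' lipBall ℓ k) := by
  obtain ⟨C, p, hC, hp, hrd⟩ := id hdecay
  obtain ⟨m, hm⟩ := exists_nat_ge p
  refine ⟨m + 1, Nat.le_add_left 1 m, Metric.totallyBounded_iff.2 fun ε hε => ?_⟩
  set η : ℝ := ε / (4 * C)
  have hη : 0 < η := by positivity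
  -- Beyond `R` both size conditions of `weight_le_mul_pow` hold, with `η ^ 2` in the role of its
  -- `η`.
  set R : ℝ := max 1 (4 ^ m / η ^ 2)
  let F : Finset (TransformationGroupoid Γ X) := (hproper.finite_setOf_le R).toFinset
  have hF : ∀ γ, γ ∈ F ↔ γ ∉ units Γ X ∧ ℓ γ ≤ R := fun γ => by simp [F]
  have hbox : TotallyBounded ((fun a : F → ℂ => toReduced (extendZero F a)) ''
      Set.univ.pi fun γ : F => Metric.closedBall (0 : ℂ) (ℓ γ ^ (m + 1))⁻¹) :=
    (isCompact_univ_pi fun γ => isCompact_closedBall _ _).totallyBounded.image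
      (uniformContinuous_extendZero hdecay F)
  obtain ⟨t, ht, hcover⟩ := Metric.totallyBounded_iff.1 hbox (ε / 2) (by positivity)
  refine ⟨t, ht, ?_⟩
  rintro _ ⟨f, hf, rfl⟩
  let a : F → ℂ := fun γ => f γ
  have hhead := hcover (Set.mem_image_of_mem (fun a : F → ℂ => toReduced (extendZero F a))
    (show a ∈ _ from fun γ _ => mem_closedBall_zero_iff.2
      (norm_apply_le_of_mem_lipBall hf ((hF γ).1 γ.2).1)))
  simp only [Set.mem_iUnion, Metric.mem_ball, exists_prop] at hhead ⊢
  obtain ⟨y, hy, hay⟩ := hhead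
  refine ⟨y, hy, ?_⟩
  -- Tail estimate: `η = ε / (4 * C)` is chosen so that the constant of rapid decay cancels.
  -- Together with the cover of the box at scale `ε / 2`, this stays below `ε`.
  have htail : dist (toReduced f) (toReduced (extendZero F a)) ≤ ε / 4 := by
    rw [dist_toReduced]
    have hsob : sobolevNorm ℓ p (f - extendZero F a) ≤ η * lipSeminorm ℓ (m + 1) f := by
      refine sobolevNorm_le_mul_lipSeminorm hη.le fun γ => ?_
      have hrhs : 0 ≤ η ^ 2 * (‖f γ‖ ^ 2 * ℓ γ ^ (2 * (m + 1))) :=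
        mul_nonneg (sq_nonneg _) (mul_nonneg (sq_nonneg _) (pow_nonneg (ℓ.nonneg γ) _))
      rw [CompactlySupportedContinuousMap.sub_apply]
      by_cases hγ : γ ∈ F
      · rw [extendZero_of_mem a hγ, sub_self]
        simpa using hrhs
      · rw [extendZero_of_notMem a hγ, sub_zero]
        -- On units the weight `ℓ ^ (2 * (m + 1))` vanishes and gives no control; the condition that
        -- `f` is zero there is what closes this case.
        by_cases hu : γ ∈ units Γ X
        · simp [hf.2 γ hu]
        · have hR : R < ℓ γ := not_le.1 fun h => hγ ((hF γ).2 ⟨hu, h⟩)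
          have hw := weight_le_mul_pow hm (pow_pos hη 2) ((le_max_left _ _).trans hR.le)
            ((le_max_right _ _).trans hR.le)
          calc _ ≤ ‖f γ‖ ^ 2 * (η ^ 2 * ℓ γ ^ (2 * (m + 1))) :=
                mul_le_mul_of_nonneg_left hw (sq_nonneg _)
            _ = _ := by ring
    calc _ ≤ C * sobolevNorm ℓ p (f - extendZero F a) := hrd _
      _ ≤ C * η := mul_le_mul_of_nonneg_left
          (hsob.trans (mul_le_of_le_one_right hη.le hf.1)) hC.le
      _ = ε / 4 := by simp only [η]; field_simp
  linarith [dist_triangle (toReduced f) (toReduced (extendZero F a)) y]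

end

theorem mainTheorem2 {Γ X : Type*} [Group Γ] [Nontrivial Γ] [TopologicalSpace Γ]
    [DiscreteTopology Γ] [TopologicalSpace X] [CompactSpace X] [T2Space X] [MulAction Γ X]
    [ContinuousConstSMul Γ X] (ℓ : LengthFunction Γ X) (hproper : ℓ.IsProper)
    (hdecay : ℓ.HasRapidDecay) :
    (∃ k : ℕ, 1 ≤ k ∧ TotallyBounded (toReduced '' lipBall ℓ k)) ↔ Finite X := by
  refine ⟨fun ⟨k, _, h⟩ => finite_of_totallyBounded_lipBall ℓ k h, fun _ => ?_⟩
  -- A finite Hausdorff space is discrete, which instance search supplies here.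
  exact exists_totallyBounded_lipBall ℓ hproper hdecay
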